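/- **Setting.** Let $\alpha>-1$. An *Orlicz function* is a strictly convex function $\psi:[0,\infty)\to[0,\infty)$ with $\psi(0)=0$, continuous at $0$, and $\psi(x)/x\to+\infty$ as $x\to\infty$. It satisfies the *$\Delta^2$-Condition* if there are $x_0>0$ and $C>0$ with $\psi(x)^2\le\psi(Cx)$ for all $x\ge x_0$. Let $\mathbb{B}_N$ be the open Euclidean unit ball of $\mathbb{C}^N$ ($N\ge1$), $\mathbb{D}=\mathbb{B}_1$ the unit disc, $dv$ the normalized Lebesgue measure on $\mathbb{B}_N$, and $$dv_\alpha(z)=c_\alpha(1-|z|^2)^\alpha\,dv(z),\qquad c_\alpha=\frac{\Gamma(N+\alpha+1)}{N!\,\Gamma(\alpha+1)}.$$ The weighted Bergman–Orlicz space $A^\psi_\alpha(\mathbb{B}_N)$ consists of the holomorphic functions $f:\mathbb{B}_N\to\mathbb{C}$ such that $\int_{\mathbb{B}_N}\psi(|f|/C)\,dv_\alpha<\infty$ for some $C>0$; it carries the Luxemburg norm $$\|f\|_\psi=\inf\Big\{C>0:\int_{\mathbb{B}_N}\psi(|f|/C)\,dv_\alpha\le1\Big\}.$$ For a holomorphic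 map $\phi:\mathbb{B}_N\to\mathbb{B}_N$, the composition operator $C_\phi f=f\circ\phi$ is *bounded on* $A^\psi_\alpha(\mathbb{B}_N)$ if it maps this space into itself and there is $M$ with $\|C_\phi f\|_\psi\le M\|f\|_\psi$ for all $f\in A^\psi_\alpha(\mathbb{B}_N)$. Let $H^\infty(\mathbb{B}_N)$ be the space of bounded holomorphic functions on $\mathbb{B}_N$. **Theorem.** Let $\alpha>-1$. 1. For every Orlicz function $\psi$ and every holomorphic $\phi:\mathbb{D}\to\mathbb{D}$, the operator $C_\phi$ is bounded on $A^\psi_\alpha(\mathbb{D})$. 2. If $N>1$ and $\psi$ is an Orlicz function satisfying the $\Delta^2$-Condition, then for every holomorphic $\phi:\mathbb{B}_N\to\mathbb{B}_N$ the operator $C_\phi$ is bounded on $A^\psi_\alpha(\mathbb{B}_N)$. 3. Consequently there are such spaces other than $H^\infty$: there is an Orlicz function $\psi$ satisfying the $\Delta^2$-Condition such that $A^\psi_\alpha(\mathbb{D})\ne H^\infty(\mathbb{D})$ and, for every $N>1$, $A^\psi_\alpha(\mathbb{B}_N)\neq H^\infty(\mathbb{B}_N)$, while every composition operator with holomorphic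 symbol is bounded on $A^\psi_\alpha(\mathbb{D})$ and on $A^\psi_\alpha(\mathbb{B}_N)$, for every $N>1$. -/

import Mathlib

open MeasureTheory Filter Topology
open scoped ENNReal

/-- An Orlicz function `ψ : ℝ₊ → ℝ₊`. It is represented by a function `ℝ → ℝ` of which only the
values on `[0, ∞)` are ever used. -/
structure IsOrliczFunction (ψ : ℝ → ℝ) : Prop where
  nonneg : ∀ x, 0 ≤ x → 0 ≤ ψ x
  strictConvexOn : StrictConvexOn ℝ (Set.Ici 0) ψ
  map_zero : ψ 0 = 0
  continuousWithinAt_zero : ContinuousWithinAt ψ (Set.Ici 0) 0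
  tendsto_div_atTop : Tendsto (fun x => ψ x / x) atTop atTop

/-- The `Δ²`-Condition: `ψ(x)² ≤ ψ(C x)` for all `x ≥ x₀`. -/
def DeltaSquareCondition (ψ : ℝ → ℝ) : Prop :=
  ∃ x₀ : ℝ, 0 < x₀ ∧ ∃ C : ℝ, 0 < C ∧ ∀ x, x₀ ≤ x → ψ x ^ 2 ≤ ψ (C * x)

section Orlicz

variable {Ω : Type*} [MeasurableSpace Ω]

/-- The modular `∫ ψ(|f| / C) dμ`, with values in `[0, ∞]`. -/
noncomputable def orliczModular (ψ : ℝ → ℝ) (μ : Measure Ω) (C : ℝ) (f : Ω → ℂ) : ℝ≥0∞ :=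
  ∫⁻ z, ENNReal.ofReal (ψ (‖f z‖ / C)) ∂μ

/-- Membership in the Orlicz space `L^ψ(μ)`. -/
def MemOrlicz (ψ : ℝ → ℝ) (μ : Measure Ω) (f : Ω → ℂ) : Prop :=
  AEStronglyMeasurable f μ ∧ ∃ C : ℝ, 0 < C ∧ orliczModular ψ μ C f < ∞

/-- The Luxemburg norm `inf {C > 0 : ∫ ψ(|f| / C) dμ ≤ 1}`. -/
noncomputable def luxemburgNorm (ψ : ℝ → ℝ) (μ : Measure Ω) (f : Ω → ℂ) : ℝ :=
  sInf {C : ℝ | 0 < C ∧ orliczModular ψ μ C f ≤ 1}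

end Orlicz

section Ball

variable (E : Type*) [NormedAddCommGroup E] [InnerProductSpace ℂ E] [MeasureSpace E]

/-- The normalized volume measure `dv` on the unit ball of `E`, as a measure on `E` that is
carried by the ball. -/
noncomputable def ballMeasure : Measure E :=
  (volume (Metric.ball (0 : E) 1))⁻¹ • (volume : Measure E).restrict (Metric.ball 0 1)

/-- The constant `c_α = Γ(N + α + 1) / (N! Γ(α + 1))`, where `N` is the complex dimension. -/
noncomputable def bergmanConst (α : ℝ) : ℝ :=
  Real.Gamma (Module.finrank ℂ E + α + 1) /
    ((Module.finrank ℂ E).factorial * Real.Gamma (α + 1))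

/-- The weighted measure `dv_α(z) = c_α (1 - |z|²)^α dv(z)` on the unit ball of `E`. -/
noncomputable def weightedBallMeasure (α : ℝ) : Measure E :=
  (ballMeasure E).withDensity
    fun z => ENNReal.ofReal (bergmanConst E α * (1 - ‖z‖ ^ 2) ^ α)

/-- The weighted Bergman–Orlicz space `A^ψ_α` on the unit ball of `E`: the functions that are
holomorphic in the ball and belong to `L^ψ(v_α)`. A function on the ball is represented by a
function on `E` of which only the values in the ball matter. -/
def bergmanOrlicz (α : ℝ) (ψ : ℝ → ℝ) : Set (E → ℂ) :=
  {f | DifferentiableOn ℂ f (Metric.ball 0 1) ∧ MemOrlicz ψ (weightedBallMeasure E α) f}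

/-- The space `H^∞` of bounded holomorphic functions on the unit ball of `E`, with the same
convention on values outside the ball. -/
def hardyInfty : Set (E → ℂ) :=
  {f | DifferentiableOn ℂ f (Metric.ball 0 1) ∧
    ∃ M : ℝ, ∀ z ∈ Metric.ball (0 : E) 1, ‖f z‖ ≤ M}

variable {E}

/-- `φ` is a holomorphic map of the unit ball of `E` into itself. -/
def IsHolomorphicSelfMap (φ : E → E) : Prop :=
  DifferentiableOn ℂ φ (Metric.ball 0 1) ∧
    Set.MapsTo φ (Metric.ball 0 1) (Metric.ball 0 1)

/-- The composition operator `C_φ f = f ∘ φ`. -/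
def compositionOperator (φ : E → E) (f : E → ℂ) : E → ℂ := f ∘ φ

/-- `C_φ` is bounded from `A^ψ_α` into itself: it maps the space into itself, and
`‖C_φ f‖ ≤ M ‖f‖` for the Luxemburg norm, with `M` independent of `f`. -/
def IsBoundedCompositionOperator (α : ℝ) (ψ : ℝ → ℝ) (φ : E → E) : Prop :=
  (∀ f ∈ bergmanOrlicz E α ψ, compositionOperator φ f ∈ bergmanOrlicz E α ψ) ∧
    ∃ M : ℝ, ∀ f ∈ bergmanOrlicz E α ψ,
      luxemburgNorm ψ (weightedBallMeasure E α) (compositionOperator φ f) ≤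
        M * luxemburgNorm ψ (weightedBallMeasure E α) f

variable (E)

/-- Every composition operator with holomorphic symbol is bounded from `A^ψ_α` into itself. -/
def EveryCompositionOperatorBounded (α : ℝ) (ψ : ℝ → ℝ) : Prop :=
  ∀ φ : E → E, IsHolomorphicSelfMap φ → IsBoundedCompositionOperator α ψ φ

end Ball

/-!
The weighted measure is pulled back along a holomorphic self-map `φ` of the ball in two different
ways, according to the dimension.

In every dimension `φ` approaches the sphere at most linearly,
`1 - |φ z| ≥ (1 - |φ 0|) (1 - |z|) / 2` (`IsHolomorphicSelfMap.le_one_sub_norm`). This is Harnack's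
inequality for the positive harmonic function `1 - Re h`, where `h` is the restriction of `φ` to a
complex line, paired with a unit vector.

On the disc, `ψ(|f|)` is dominated by the Poisson integral of its values on any circle
(`IsOrliczFunction.map_norm_le_circleAverage`, which is Jensen's inequality). That Poisson integral
is the real part of a holomorphic function, so that the mean value property of its composition with
`φ` bounds the mean of `ψ(|f ∘ φ|)` over the circle of radius `r` by a constant times the mean of
`ψ(|f|)` over any circle whose disc contains the image. By the previous estimate the radius
`1 - c (1 - r)` is admissible for a fixed `c > 0`, and an affine change of the radial variable gives
`∫ ψ(|f ∘ φ|) dv_α ≤ K ∫ ψ(|f|) dv_α` (`IsOrliczFunction.orliczModular_comp_le`). Convexity of `ψ`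
turns the factor `K` into a factor `K` for the Luxemburg norm.

In higher dimension such an inequality fails for some `φ`, and the `Δ²`-Condition replaces it. If
the modular of `f` is at most `1`, the sub-mean value property of `ψ(|f|)` on small balls gives
`ψ(|f(w)|) ≤ K (1 - |w|) ^ (-β)`, hence the same bound, with another constant, for
`ψ(|f(φ z)|)` in terms of `1 - |z|`. Iterating the `Δ²`-Condition `k` times gives
`ψ(x / A) ^ 2 ^ k ≤ B (1 + ψ(x))` (`IsOrliczFunction.exists_pow_map_div_le`), so after dividing by
`A` the exponent `β` becomes `β / 2 ^ k`, which is less than `α + 1` for large `k`: the bound is then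
integrable (`IsOrliczFunction.everyCompositionOperatorBounded`).

For the last claim take `ψ(x) = exp x - 1`: the function `log (1 - ⟨u, z⟩)`, with `u` a unit vector,
is unbounded, but its exponential is a negative power, so that it belongs to the space.
-/

/-! ### Orlicz functions -/

namespace IsOrliczFunction

variable {ψ : ℝ → ℝ}

theorem map_mul_le (hψ : IsOrliczFunction ψ) {t x : ℝ} (ht₀ : 0 ≤ t) (ht₁ : t ≤ 1) (hx : 0 ≤ x) :
    ψ (t * x) ≤ t * ψ x := by
  have h := hψ.strictConvexOn.convexOn.2 (Set.mem_Ici.2 hx) (Set.mem_Ici.2 le_rfl) ht₀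
    (sub_nonneg.2 ht₁) (by ring)
  simpa [hψ.map_zero] using h

theorem map_div_le (hψ : IsOrliczFunction ψ) {K x : ℝ} (hK : 1 ≤ K) (hx : 0 ≤ x) :
    ψ (x / K) ≤ ψ x / K := by
  have h := hψ.map_mul_le (inv_nonneg.2 (zero_le_one.trans hK)) (inv_le_one_of_one_le₀ hK) hx
  rwa [inv_mul_eq_div, inv_mul_eq_div] at h

theorem mono (hψ : IsOrliczFunction ψ) {x y : ℝ} (hx : 0 ≤ x) (hxy : x ≤ y) : ψ x ≤ ψ y := by
  rcases hx.eq_or_lt with rfl | hx'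
  · rw [hψ.map_zero]
    exact hψ.nonneg y hxy
  have hy : 0 < y := hx'.trans_le hxy
  have h := hψ.map_mul_le (div_nonneg hx hy.le) ((div_le_one hy).2 hxy) hy.le
  rw [div_mul_cancel₀ _ hy.ne'] at h
  exact h.trans (mul_le_of_le_one_left (hψ.nonneg y hy.le) ((div_le_one hy).2 hxy))

theorem continuousOn (hψ : IsOrliczFunction ψ) : ContinuousOn ψ (Set.Ici 0) := by
  intro x hx
  rcases (Set.mem_Ici.1 hx).eq_or_lt with rfl | hx'
  · exact hψ.continuousWithinAt_zero
  · have h := hψ.strictConvexOn.convexOn.continuousOn_interior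
    rw [interior_Ici] at h
    exact (h.continuousAt (Ioi_mem_nhds hx')).continuousWithinAt

/-- An Orlicz function has a supporting line of nonnegative slope at each point of `[0, ∞)`. -/
theorem exists_supporting_line (hψ : IsOrliczFunction ψ) {x₀ : ℝ} (hx₀ : 0 ≤ x₀) :
    ∃ m, 0 ≤ m ∧ ∀ x, 0 ≤ x → ψ x₀ + m * (x - x₀) ≤ ψ x := by
  rcases hx₀.eq_or_lt with rfl | hx
  · exact ⟨0, le_rfl, fun x hx => by simpa [hψ.map_zero] using hψ.nonneg x hx⟩
  have hc := hψ.strictConvexOn.convexOn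
  have hint : x₀ ∈ interior (Set.Ici (0 : ℝ)) := by rwa [interior_Ici]
  have key : ∀ x, 0 ≤ x → ψ x₀ + derivWithin ψ (Set.Ioi x₀) x₀ * (x - x₀) ≤ ψ x := by
    intro x hx0
    rcases lt_trichotomy x x₀ with hlt | rfl | hgt
    · have h1 := (hc.slope_le_leftDeriv_of_mem_interior (Set.mem_Ici.2 hx0) hint hlt).trans
        (hc.leftDeriv_le_rightDeriv_of_mem_interior hint)
      rw [slope_def_field, div_le_iff₀ (sub_pos.2 hlt)] at h1
      linarith
    · simp
    · have h1 := hc.rightDeriv_le_slope_of_mem_interior hint (Set.mem_Ici.2 hx0) hgt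
      rw [slope_def_field, le_div_iff₀ (sub_pos.2 hgt)] at h1
      linarith
  refine ⟨_, ?_, key⟩
  have h0 := key 0 le_rfl
  rw [hψ.map_zero] at h0
  have h1 := hψ.nonneg x₀ hx₀
  by_contra! hneg
  nlinarith

/-- Iterating the `Δ²`-Condition `k` times: after a dilation of the variable, the `2 ^ k`-th power
of `ψ` is dominated by `ψ`. -/
theorem exists_pow_map_div_le (hψ : IsOrliczFunction ψ) (hΔ : DeltaSquareCondition ψ) (k : ℕ) :
    ∃ A, 1 ≤ A ∧ ∃ B, 0 ≤ B ∧ ∀ x, 0 ≤ x → ψ (x / A) ^ 2 ^ k ≤ B * (1 + ψ x) := by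
  obtain ⟨x₀, hx₀, C, hC, h⟩ := hΔ
  induction k with
  | zero =>
    refine ⟨1, le_rfl, 1, zero_le_one, fun x hx => ?_⟩
    simp
  | succ k ih =>
    obtain ⟨A, hA, B, hB, hAB⟩ := ih
    set D := max C 1
    have hD : 1 ≤ D := le_max_right _ _
    have hD0 : 0 < D := zero_lt_one.trans_le hD
    have hsq : ∀ y, 0 ≤ y → ψ y ^ 2 ≤ ψ x₀ ^ 2 + ψ (D * y) := by
      intro y hy
      rcases le_total x₀ y with hy' | hy'
      · have h1 := h y hy'
        have h2 : ψ (C * y) ≤ ψ (D * y) :=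
          hψ.mono (by positivity) (mul_le_mul_of_nonneg_right (le_max_left _ _) hy)
        nlinarith [sq_nonneg (ψ x₀)]
      · have h1 := pow_le_pow_left₀ (hψ.nonneg y hy) (hψ.mono hy hy') 2
        have h2 := hψ.nonneg (D * y) (by positivity)
        linarith
    refine ⟨D * A, one_le_mul_of_one_le_of_one_le hD hA, 2 * B ^ 2 * (1 + ψ x₀ ^ 2),
      by positivity, fun x hx => ?_⟩
    have hxD : 0 ≤ x / D := by positivity
    have h1 := hAB (x / D) hxD
    have h2 := hsq (x / D) hxD
    rw [mul_div_cancel₀ _ hD0.ne'] at h2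
    have h3 := hψ.nonneg x hx
    have h4 := hψ.nonneg _ hxD
    have h5 : 0 ≤ ψ (x / D / A) := hψ.nonneg _ (by positivity)
    rw [pow_succ, pow_mul, ← div_div]
    calc (ψ (x / D / A) ^ 2 ^ k) ^ 2 ≤ (B * (1 + ψ (x / D))) ^ 2 := by gcongr
      _ = B ^ 2 * (1 + ψ (x / D)) ^ 2 := by ring
      _ ≤ B ^ 2 * (2 * (1 + ψ (x / D) ^ 2)) := by
        gcongr
        nlinarith [sq_nonneg (1 - ψ (x / D))]
      _ ≤ B ^ 2 * (2 * ((1 + ψ x₀ ^ 2) * (1 + ψ x))) := by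
        gcongr
        nlinarith [sq_nonneg (ψ x₀), mul_nonneg (sq_nonneg (ψ x₀)) h3]
      _ = 2 * B ^ 2 * (1 + ψ x₀ ^ 2) * (1 + ψ x) := by ring

end IsOrliczFunction

theorem isOrliczFunction_exp_sub_one : IsOrliczFunction fun x => Real.exp x - 1 where
  nonneg x hx := by
    have := Real.one_le_exp hx
    linarith
  strictConvexOn := by
    have h := strictConvexOn_exp.subset (Set.subset_univ (Set.Ici (0 : ℝ))) (convex_Ici 0)
    refine (h.add_convexOn (convexOn_const (-1 : ℝ) (convex_Ici 0))).congr fun x _ => ?_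
    simp [sub_eq_add_neg]
  map_zero := by simp
  continuousWithinAt_zero := by
    apply Continuous.continuousWithinAt
    fun_prop
  tendsto_div_atTop := by
    have h1 : Tendsto (fun x : ℝ => Real.exp x / x) atTop atTop := by
      simpa using Real.tendsto_exp_div_pow_atTop 1
    have h2 : Tendsto (fun x : ℝ => -x⁻¹) atTop (𝓝 (-0)) := tendsto_inv_atTop_zero.neg
    refine (h1.atTop_add h2).congr fun x => ?_
    ring

theorem deltaSquareCondition_exp_sub_one : DeltaSquareCondition fun x => Real.exp x - 1 := by
  refine ⟨1, one_pos, 2, two_pos, fun x hx => ?_⟩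
  have h := Real.one_le_exp (zero_le_one.trans hx)
  have h2 : Real.exp (2 * x) = Real.exp x ^ 2 := by
    rw [← Real.exp_nat_mul]
    norm_num
  simp only [h2]
  nlinarith

/-! ### Estimates on circles -/

theorem poissonKernel_nonneg {R : ℝ} {w z : ℂ} (hz : z ∈ Metric.sphere (0 : ℂ) R)
    (hw : w ∈ Metric.ball (0 : ℂ) R) : 0 ≤ poissonKernel 0 w z := by
  rw [mem_sphere_zero_iff_norm] at hz
  rw [mem_ball_zero_iff] at hw
  have := norm_nonneg w
  simp only [poissonKernel_def, sub_zero, hz]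
  apply div_nonneg _ (by positivity)
  nlinarith

theorem poissonKernel_le {R : ℝ} {w z : ℂ} (hz : z ∈ Metric.sphere (0 : ℂ) R)
    (hw : w ∈ Metric.ball (0 : ℂ) R) : poissonKernel 0 w z ≤ (R + ‖w‖) / (R - ‖w‖) := by
  rw [poissonKernel_eq_re_herglotzRieszKernel]
  simpa [herglotzRieszKernel] using re_herglotzRieszKernel_le hz hw

theorem le_poissonKernel {R : ℝ} {w z : ℂ} (hz : z ∈ Metric.sphere (0 : ℂ) R)
    (hw : w ∈ Metric.ball (0 : ℂ) R) : (R - ‖w‖) / (R + ‖w‖) ≤ poissonKernel 0 w z := by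
  rw [poissonKernel_eq_re_herglotzRieszKernel]
  simpa [herglotzRieszKernel] using le_re_herglotzRieszKernel hz hw

theorem continuousOn_poissonKernel_sphere {R : ℝ} {w : ℂ} (hw : w ∈ Metric.ball (0 : ℂ) R) :
    ContinuousOn (poissonKernel 0 w) (Metric.sphere 0 |R|) := by
  rw [poissonKernel_eq_re_herglotzRieszKernel]
  exact Complex.continuous_re.comp_continuousOn (continuousOn_herglotzRieszKernel_sphere hw)

/-- Harnack's inequality for the positive harmonic function `1 - Re h` on the unit disc. -/
theorem harnack_one_sub_re {h : ℂ → ℂ} (hd : DifferentiableOn ℂ h (Metric.ball 0 1))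
    (hre : ∀ z ∈ Metric.ball (0 : ℂ) 1, (h z).re ≤ 1) {z : ℂ} (hz : z ∈ Metric.ball (0 : ℂ) 1) :
    (1 - ‖z‖) / 2 * (1 - (h 0).re) ≤ 1 - (h z).re := by
  have hz' : ‖z‖ < 1 := by simpa using hz
  have key : ∀ R ∈ Set.Ioo ‖z‖ 1, (R - ‖z‖) / 2 * (1 - (h 0).re) ≤ 1 - (h z).re := by
    intro R hR
    have hR0 : 0 < R := (norm_nonneg z).trans_lt hR.1
    have hzR : z ∈ Metric.ball (0 : ℂ) R := by simpa using hR.1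
    have hsub : Metric.closedBall (0 : ℂ) R ⊆ Metric.ball 0 1 :=
      Metric.closedBall_subset_ball hR.2
    have hsph : Metric.sphere (0 : ℂ) |R| ⊆ Metric.closedBall (0 : ℂ) R := by
      rw [abs_of_pos hR0]
      exact Metric.sphere_subset_closedBall
    set k : ℂ → ℂ := fun w => 1 - h w
    have hk : DifferentiableOn ℂ k (Metric.closedBall 0 R) :=
      (differentiableOn_const 1).sub (hd.mono hsub)
    have hkd : DiffContOnCl ℂ k (Metric.ball 0 R) := hk.diffContOnCl_ball subset_rfl
    have hkc : ContinuousOn k (Metric.sphere 0 |R|) := hk.continuousOn.mono hsph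
    have hP := continuousOn_poissonKernel_sphere hzR
    have e1 : (k z).re = Real.circleAverage (fun w => poissonKernel 0 z w * (k w).re) 0 R := by
      rw [← hkd.circleAverage_poissonKernel_smul hzR]
      have := Complex.reCLM.circleAverage_comp_comm (f := poissonKernel 0 z • k) (c := 0) (R := R)
        ((hP.smul hkc).circleIntegrable')
      simp only [Complex.reCLM_apply] at this
      rw [← this]
      congr 1
      ext w
      simp
    have e2 : (k 0).re = Real.circleAverage (fun w => (k w).re) 0 R := by
      have h2 : Real.circleAverage k 0 R = k 0 :=
        DiffContOnCl.circleAverage (by rwa [abs_of_pos hR0])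
      rw [← h2]
      exact (Complex.reCLM.circleAverage_comp_comm hkc.circleIntegrable').symm
    have hkre : ContinuousOn (fun w => (k w).re) (Metric.sphere 0 |R|) :=
      Complex.continuous_re.comp_continuousOn hkc
    have e3 : (R - ‖z‖) / 2 * (k 0).re ≤ (k z).re := by
      rw [e1, e2, ← smul_eq_mul, ← Real.circleAverage_fun_smul]
      refine Real.circleAverage_mono (f₁ := fun w => ((R - ‖z‖) / 2) • (k w).re)
        (f₂ := fun w => poissonKernel 0 z w * (k w).re)
        (hkre.const_smul ((R - ‖z‖) / 2)).circleIntegrable' (hP.mul hkre).circleIntegrable' ?_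
      intro w hw
      have hw1 := hsub (hsph hw)
      rw [abs_of_pos hR0] at hw
      have h0 : 0 ≤ (k w).re := by simpa [k] using hre w hw1
      have h1 : (R - ‖z‖) / 2 ≤ poissonKernel 0 z w := by
        refine le_trans ?_ (le_poissonKernel hw hzR)
        apply div_le_div_of_nonneg_left (by linarith [hR.1]) (by positivity)
        linarith [hR.1, hR.2]
      simpa using mul_le_mul_of_nonneg_right h1 h0
    simpa [k] using e3
  have hT : Tendsto (fun R : ℝ => (R - ‖z‖) / 2 * (1 - (h 0).re)) (𝓝[<] 1)
      (𝓝 ((1 - ‖z‖) / 2 * (1 - (h 0).re))) :=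
    tendsto_nhdsWithin_of_tendsto_nhds (Continuous.tendsto (by fun_prop) 1)
  exact le_of_tendsto hT (by
    filter_upwards [Ioo_mem_nhdsLT hz'] with R hR using key R hR)

/-- Jensen's inequality for the Poisson integral: the function `ψ(|f|)` is dominated by the Poisson
integral of its values on a circle, that is, it is subharmonic. -/
theorem IsOrliczFunction.map_norm_le_circleAverage {ψ : ℝ → ℝ} (hψ : IsOrliczFunction ψ)
    {f : ℂ → ℂ} {R : ℝ} (hf : DifferentiableOn ℂ f (Metric.closedBall 0 R))
    {w : ℂ} (hw : w ∈ Metric.ball (0 : ℂ) R) :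
    ψ ‖f w‖ ≤ Real.circleAverage (fun z => poissonKernel 0 w z * ψ ‖f z‖) 0 R := by
  have hR0 : 0 < R := Metric.pos_of_mem_ball hw
  have hfd : DiffContOnCl ℂ f (Metric.ball 0 R) := hf.diffContOnCl_ball subset_rfl
  have hsph : Metric.sphere (0 : ℂ) |R| ⊆ Metric.closedBall (0 : ℂ) R := by
    rw [abs_of_pos hR0]
    exact Metric.sphere_subset_closedBall
  have hfc : ContinuousOn f (Metric.sphere 0 |R|) := hf.continuousOn.mono hsph
  have hP := continuousOn_poissonKernel_sphere hw
  have hψc : ContinuousOn (fun z => ψ ‖f z‖) (Metric.sphere 0 |R|) :=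
    hψ.continuousOn.comp hfc.norm fun z _ => norm_nonneg _
  obtain ⟨m, hm, hline⟩ := hψ.exists_supporting_line (norm_nonneg (f w))
  have one : Real.circleAverage (poissonKernel 0 w) 0 R = 1 := by
    have h1 := (diffContOnCl_const (c := (1 : ℂ)) :
      DiffContOnCl ℂ (fun _ : ℂ => (1 : ℂ)) (Metric.ball 0 R)).circleAverage_poissonKernel_smul hw
    have h2 := Complex.reCLM.circleAverage_comp_comm
      (f := poissonKernel 0 w • fun _ : ℂ => (1 : ℂ)) (c := 0) (R := R)
      ((hP.smul continuousOn_const).circleIntegrable')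
    rw [h1] at h2
    have h3 : (fun x : ℂ => Complex.reCLM x) ∘ (poissonKernel 0 w • fun _ : ℂ => (1 : ℂ)) =
        poissonKernel 0 w := by
      ext z
      simp
    simpa [h3] using h2
  have hn : ‖f w‖ ≤ Real.circleAverage (fun z => poissonKernel 0 w z * ‖f z‖) 0 R := by
    conv_lhs => rw [← hfd.circleAverage_poissonKernel_smul hw]
    rw [Real.circleAverage_def, Real.circleAverage_def, norm_smul, Real.norm_eq_abs,
      abs_of_pos (by positivity), smul_eq_mul]
    gcongr
    refine (intervalIntegral.norm_integral_le_integral_norm (by positivity)).trans_eq ?_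
    refine intervalIntegral.integral_congr fun θ _ => ?_
    have : circleMap 0 R θ ∈ Metric.sphere (0 : ℂ) R := circleMap_mem_sphere _ hR0.le _
    simp [abs_of_nonneg (poissonKernel_nonneg this hw)]
  have hPf : ContinuousOn (fun z => poissonKernel 0 w z * ‖f z‖) (Metric.sphere 0 |R|) :=
    hP.mul hfc.norm
  have h₁ : ContinuousOn (fun z => (ψ ‖f w‖ - m * ‖f w‖) • poissonKernel 0 w z)
      (Metric.sphere 0 |R|) := hP.const_smul (ψ ‖f w‖ - m * ‖f w‖)
  have h₂ : ContinuousOn (fun z => m • (poissonKernel 0 w z * ‖f z‖)) (Metric.sphere 0 |R|) :=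
    hPf.const_smul m
  calc ψ ‖f w‖ ≤ (ψ ‖f w‖ - m * ‖f w‖) * Real.circleAverage (poissonKernel 0 w) 0 R +
        m * Real.circleAverage (fun z => poissonKernel 0 w z * ‖f z‖) 0 R := by
        rw [one]
        nlinarith [mul_le_mul_of_nonneg_left hn hm]
    _ = Real.circleAverage (fun z => (ψ ‖f w‖ - m * ‖f w‖) • poissonKernel 0 w z +
        m • (poissonKernel 0 w z * ‖f z‖)) 0 R := by
        rw [Real.circleAverage_fun_add
          (f₁ := fun z => (ψ ‖f w‖ - m * ‖f w‖) • poissonKernel 0 w z)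
          (f₂ := fun z => m • (poissonKernel 0 w z * ‖f z‖))
          h₁.circleIntegrable' h₂.circleIntegrable', Real.circleAverage_fun_smul,
          Real.circleAverage_fun_smul, smul_eq_mul, smul_eq_mul]
    _ ≤ _ := by
        refine Real.circleAverage_mono (f₂ := fun z => poissonKernel 0 w z * ψ ‖f z‖)
          (h₁.add h₂).circleIntegrable' (hP.mul hψc).circleIntegrable' ?_
        intro z hz
        rw [abs_of_pos hR0] at hz
        have h1 := mul_le_mul_of_nonneg_left (hline ‖f z‖ (norm_nonneg _))
          (poissonKernel_nonneg hz hw)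
        simp only [smul_eq_mul]
        nlinarith

/-- Littlewood's subordination principle on circles: if `φ` maps the disc of radius `r` into the
disc of radius `ρ`, the mean of `ψ(|f ∘ φ|)` over the circle of radius `r` is controlled by the mean
of `ψ(|f|)` over the circle of radius `ρ`. -/
theorem IsOrliczFunction.circleAverage_comp_le {ψ : ℝ → ℝ} (hψ : IsOrliczFunction ψ)
    {f φ : ℂ → ℂ} {r ρ : ℝ} (hr : 0 < r) (hf : DifferentiableOn ℂ f (Metric.closedBall 0 ρ))
    (hφ : DifferentiableOn ℂ φ (Metric.closedBall 0 r))
    (hmaps : Set.MapsTo φ (Metric.closedBall 0 r) (Metric.ball 0 ρ)) :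
    Real.circleAverage (fun z => ψ ‖f (φ z)‖) 0 r ≤
      (ρ + ‖φ 0‖) / (ρ - ‖φ 0‖) * Real.circleAverage (fun z => ψ ‖f z‖) 0 ρ := by
  have h0 : φ 0 ∈ Metric.ball (0 : ℂ) ρ := hmaps (Metric.mem_closedBall_self hr.le)
  have hρ : 0 < ρ := Metric.pos_of_mem_ball h0
  have hsph : Metric.sphere (0 : ℂ) |ρ| ⊆ Metric.closedBall (0 : ℂ) ρ := by
    rw [abs_of_pos hρ]
    exact Metric.sphere_subset_closedBall
  have hsphr : Metric.sphere (0 : ℂ) |r| ⊆ Metric.closedBall (0 : ℂ) r := by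
    rw [abs_of_pos hr]
    exact Metric.sphere_subset_closedBall
  have hψf : ContinuousOn (fun z => ψ ‖f z‖) (Metric.closedBall 0 ρ) :=
    hψ.continuousOn.comp hf.continuousOn.norm fun z _ => norm_nonneg _
  have hg : CircleIntegrable (fun z => ψ ‖f z‖) 0 ρ := (hψf.mono hsph).circleIntegrable'
  have hgC : CircleIntegrable (fun z => ((ψ ‖f z‖ : ℝ) : ℂ)) 0 ρ :=
    (Complex.continuous_ofReal.comp_continuousOn (hψf.mono hsph)).circleIntegrable'
  -- `F` is the holomorphic function whose real part is the Poisson integral of `ψ(|f|)`.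
  set F : ℂ → ℂ := fun w =>
    Real.circleAverage (fun ζ => herglotzRieszKernel 0 w ζ • ((ψ ‖f ζ‖ : ℝ) : ℂ)) 0 ρ
  have hF : DifferentiableOn ℂ F (Metric.ball 0 ρ) :=
    differentiableOn_circleAverage_herglotzRieszKernel_smul hgC
  have hFre : ∀ w ∈ Metric.ball (0 : ℂ) ρ,
      (F w).re = Real.circleAverage (fun z => poissonKernel 0 w z * ψ ‖f z‖) 0 ρ := by
    intro w hw
    rw [poissonKernel_eq_re_herglotzRieszKernel]
    exact re_circleAverage_herglotzRieszKernel_smul hg hw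
  have hFφ : DifferentiableOn ℂ (F ∘ φ) (Metric.closedBall 0 r) := hF.comp hφ hmaps
  have hmean : Real.circleAverage (F ∘ φ) 0 r = F (φ 0) :=
    DiffContOnCl.circleAverage (by
      rw [abs_of_pos hr]
      exact hFφ.diffContOnCl_ball subset_rfl)
  have hFφc : ContinuousOn (F ∘ φ) (Metric.sphere 0 |r|) := hFφ.continuousOn.mono hsphr
  have hmean' : Real.circleAverage (fun z => (F (φ z)).re) 0 r = (F (φ 0)).re := by
    rw [← hmean]
    exact Complex.reCLM.circleAverage_comp_comm hFφc.circleIntegrable'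
  calc Real.circleAverage (fun z => ψ ‖f (φ z)‖) 0 r
      ≤ Real.circleAverage (fun z => (F (φ z)).re) 0 r := by
        apply Real.circleAverage_mono
        · exact ((hψf.comp hφ.continuousOn
            (hmaps.mono_right Metric.ball_subset_closedBall)).mono hsphr).circleIntegrable'
        · exact (Complex.continuous_re.comp_continuousOn hFφc).circleIntegrable'
        · intro z hz
          have hz' := hmaps (hsphr hz)
          rw [hFre _ hz']
          exact hψ.map_norm_le_circleAverage hf hz'
    _ = Real.circleAverage (fun z => poissonKernel 0 (φ 0) z * ψ ‖f z‖) 0 ρ := by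
        rw [hmean', hFre _ h0]
    _ ≤ Real.circleAverage (fun z => ((ρ + ‖φ 0‖) / (ρ - ‖φ 0‖)) • ψ ‖f z‖) 0 ρ := by
        apply Real.circleAverage_mono
        · exact ((continuousOn_poissonKernel_sphere h0).mul (hψf.mono hsph)).circleIntegrable'
        · exact ((hψf.mono hsph).const_smul ((ρ + ‖φ 0‖) / (ρ - ‖φ 0‖))).circleIntegrable'
        · intro z hz
          rw [abs_of_pos hρ] at hz
          exact mul_le_mul_of_nonneg_right (poissonKernel_le hz h0) (hψ.nonneg _ (norm_nonneg _))
    _ = _ := by rw [Real.circleAverage_fun_smul, smul_eq_mul]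

/-! ### The growth of holomorphic self-maps of the ball -/

/-- A Schwarz–Pick type estimate: a holomorphic self-map of the ball approaches the sphere at most
linearly. It is Harnack's inequality on the slice through `z`, in the direction of `φ z`. -/
theorem IsHolomorphicSelfMap.le_one_sub_norm {E : Type*} [NormedAddCommGroup E]
    [InnerProductSpace ℂ E] [MeasureSpace E] {φ : E → E} (hφ : IsHolomorphicSelfMap φ) {z : E}
    (hz : z ∈ Metric.ball (0 : E) 1) : (1 - ‖φ 0‖) / 2 * (1 - ‖z‖) ≤ 1 - ‖φ z‖ := by
  have hz' : ‖z‖ < 1 := by simpa using hz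
  set v : E := ((‖φ z‖⁻¹ : ℝ) : ℂ) • φ z
  have hv : ‖v‖ ≤ 1 := by
    simp only [v, norm_smul, Complex.norm_real, norm_inv, norm_norm]
    exact inv_mul_le_one
  set e : E := ((‖z‖⁻¹ : ℝ) : ℂ) • z
  have he : ‖e‖ ≤ 1 := by
    simp only [e, norm_smul, Complex.norm_real, norm_inv, norm_norm]
    exact inv_mul_le_one
  have hmaps : Set.MapsTo (fun t : ℂ => t • e) (Metric.ball 0 1) (Metric.ball 0 1) := by
    intro t ht
    rw [mem_ball_zero_iff] at ht ⊢
    rw [norm_smul]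
    exact (mul_le_of_le_one_right (norm_nonneg t) he).trans_lt ht
  have hre : ∀ t ∈ Metric.ball (0 : ℂ) 1, (innerSL ℂ v (φ (t • e))).re ≤ ‖φ (t • e)‖ := by
    intro t _
    rw [innerSL_apply_apply]
    exact (Complex.re_le_norm _).trans ((norm_inner_le_norm _ _).trans
      (mul_le_of_le_one_left (norm_nonneg _) hv))
  have h := harnack_one_sub_re (h := fun t => innerSL ℂ v (φ (t • e)))
    ((innerSL ℂ v).differentiable.comp_differentiableOn
      (hφ.1.comp (differentiable_id.smul_const e).differentiableOn hmaps))
    (fun t ht => (hre t ht).trans ((mem_ball_zero_iff.1 (hφ.2 (hmaps ht))).le))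
    (z := (‖z‖ : ℂ)) (by simpa using hz')
  have hez : (‖z‖ : ℂ) • e = z := by
    rcases eq_or_ne z 0 with rfl | hne
    · simp
    · simp [e, smul_smul, hne]
  have hvz : (innerSL ℂ v (φ z)).re = ‖φ z‖ := by
    rw [innerSL_apply_apply]
    rcases eq_or_ne (φ z) 0 with h0 | hne
    · simp [h0]
    · have hne' : ‖φ z‖ ≠ 0 := norm_ne_zero_iff.2 hne
      have h1 : (inner ℂ (φ z) (φ z)).re = ‖φ z‖ ^ 2 := inner_self_eq_norm_sq (𝕜 := ℂ) (φ z)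
      simp only [v, inner_smul_left, Complex.conj_ofReal, Complex.re_ofReal_mul, h1]
      field_simp
  have h0 := hre 0 (by simp)
  simp only [zero_smul, hez, hvz, Complex.norm_real, norm_norm] at h h0
  nlinarith [norm_nonneg z]

/-! ### Circle averages and polar coordinates -/

theorem lintegral_circleMap_eq {g : ℂ → ℝ} {R : ℝ} (hR : 0 ≤ R)
    (hg : ContinuousOn g (Metric.sphere 0 R)) (h0 : ∀ z ∈ Metric.sphere (0 : ℂ) R, 0 ≤ g z) :
    ∫⁻ θ in Set.Ioo (-Real.pi) Real.pi, ENNReal.ofReal (g (circleMap 0 R θ)) =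
      ENNReal.ofReal (2 * Real.pi * Real.circleAverage g 0 R) := by
  have hc : Continuous fun θ : ℝ => g (circleMap 0 R θ) :=
    hg.comp_continuous (by fun_prop) fun θ => circleMap_mem_sphere _ hR θ
  have hpi := Real.pi_pos
  have hI : IntegrableOn (fun θ : ℝ => g (circleMap 0 R θ)) (Set.Ioc (-Real.pi) Real.pi) :=
    (hc.integrableOn_Icc).mono_set Set.Ioc_subset_Icc_self
  rw [Real.circleAverage_eq_integral_add (-Real.pi), smul_eq_mul,
    intervalIntegral.integral_comp_add_right (fun θ : ℝ => g (circleMap 0 R θ)),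
    mul_inv_cancel_left₀ (by positivity)]
  have e : 2 * Real.pi + -Real.pi = Real.pi := by ring
  rw [e, zero_add, intervalIntegral.integral_of_le (by linarith),
    ofReal_integral_eq_lintegral_ofReal hI
      (ae_of_all _ fun θ => h0 _ (circleMap_mem_sphere _ hR θ)), restrict_Ioo_eq_restrict_Ioc]

/-- Integration in polar coordinates over the unit disc, with a radial weight. -/
theorem lintegral_ball_eq_lintegral_circleAverage {g : ℂ → ℝ} {ω : ℝ → ℝ≥0∞}
    (hg : ContinuousOn g (Metric.ball 0 1)) (h0 : ∀ z ∈ Metric.ball (0 : ℂ) 1, 0 ≤ g z)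
    (hω : Measurable ω) :
    ∫⁻ z in Metric.ball (0 : ℂ) 1, ω ‖z‖ * ENNReal.ofReal (g z) =
      ∫⁻ r in Set.Ioo (0 : ℝ) 1, ENNReal.ofReal r * ω r *
        ENNReal.ofReal (2 * Real.pi * Real.circleAverage g 0 r) := by
  set g' : ℂ → ℝ := (Metric.ball (0 : ℂ) 1).indicator g
  have hg' : Measurable g' := by
    classical
    rw [show g' = (Metric.ball (0 : ℂ) 1).piecewise g 0 from Set.piecewise_eq_indicator.symm]
    exact hg.measurable_piecewise continuousOn_const measurableSet_ball
  have hcm : ∀ r θ : ℝ, Complex.polarCoord.symm (r, θ) = circleMap 0 r θ := by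
    intro r θ
    simp [Complex.polarCoord_symm_apply, circleMap, Complex.exp_mul_I]
  have hind : (Metric.ball (0 : ℂ) 1).indicator (fun z => ω ‖z‖ * ENNReal.ofReal (g z)) =
      fun z => ω ‖z‖ * ENNReal.ofReal (g' z) := by
    ext z
    by_cases hz : z ∈ Metric.ball (0 : ℂ) 1
    · simp only [Set.indicator_of_mem hz, g']
    · simp only [Set.indicator_of_notMem hz, g', ENNReal.ofReal_zero, mul_zero]
  rw [← lintegral_indicator measurableSet_ball, hind, ← Complex.lintegral_comp_polarCoord_symm,
    polarCoord_target, Measure.volume_eq_prod, ← Measure.prod_restrict, lintegral_prod]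
  · have hin : ∀ r ∈ Set.Ioi (0 : ℝ),
        ∫⁻ θ in Set.Ioo (-Real.pi) Real.pi, ENNReal.ofReal r • (ω ‖Complex.polarCoord.symm (r, θ)‖ *
          ENNReal.ofReal (g' (Complex.polarCoord.symm (r, θ)))) =
        (Set.Ioo (0 : ℝ) 1).indicator (fun r => ENNReal.ofReal r * ω r *
          ENNReal.ofReal (2 * Real.pi * Real.circleAverage g 0 r)) r := by
      intro r hr
      have hr0 : 0 < r := hr
      simp only [hcm, norm_circleMap_zero, abs_of_pos hr0, smul_eq_mul, ← mul_assoc]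
      by_cases hr1 : r < 1
      · have hsub : Metric.sphere (0 : ℂ) r ⊆ Metric.ball 0 1 := fun z hz => by
          rw [mem_sphere_zero_iff_norm] at hz
          rwa [mem_ball_zero_iff, hz]
        rw [Set.indicator_of_mem (show r ∈ Set.Ioo (0 : ℝ) 1 from ⟨hr0, hr1⟩),
          ← lintegral_circleMap_eq hr0.le (hg.mono hsub) fun z hz => h0 z (hsub hz),
          lintegral_const_mul _ (by fun_prop)]
        congr 1
        refine lintegral_congr fun θ => ?_
        rw [show g' (circleMap 0 r θ) = g (circleMap 0 r θ) from
          Set.indicator_of_mem (hsub (circleMap_mem_sphere _ hr0.le θ)) g]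
      · rw [Set.indicator_of_notMem (fun h => hr1 h.2)]
        have : ∀ θ, g' (circleMap 0 r θ) = 0 := fun θ =>
          Set.indicator_of_notMem (fun h => hr1 (by simpa [abs_of_pos hr0] using h)) g
        simp [this]
    rw [setLIntegral_congr_fun measurableSet_Ioi hin, lintegral_indicator measurableSet_Ioo,
      Measure.restrict_restrict measurableSet_Ioo, Set.inter_eq_left.2 Set.Ioo_subset_Ioi_self]
  · have hm : Measurable fun p : ℝ × ℝ => Complex.polarCoord.symm p := by
      have : (fun p : ℝ × ℝ => Complex.polarCoord.symm p) = fun p => circleMap 0 p.1 p.2 :=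
        funext fun p => hcm p.1 p.2
      rw [this]
      unfold circleMap
      fun_prop
    apply Measurable.aemeasurable
    simp only [smul_eq_mul]
    fun_prop

/-! ### The weighted measure -/

theorem bergmanConst_pos {E : Type*} [NormedAddCommGroup E] [InnerProductSpace ℂ E] {α : ℝ}
    (hα : -1 < α) : 0 < bergmanConst E α := by
  have h1 : 0 < Real.Gamma (α + 1) := Real.Gamma_pos_of_pos (by linarith)
  have h2 : 0 < Real.Gamma (Module.finrank ℂ E + α + 1) :=
    Real.Gamma_pos_of_pos (by linarith [(Nat.cast_nonneg (Module.finrank ℂ E) : (0 : ℝ) ≤ _)])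
  have h3 := Nat.factorial_pos (Module.finrank ℂ E)
  unfold bergmanConst
  positivity

theorem volume_ball_ne_zero {E : Type*} [NormedAddCommGroup E] [MeasureSpace E]
    [(volume : Measure E).IsAddHaarMeasure] : volume (Metric.ball (0 : E) 1) ≠ 0 :=
  (Metric.measure_ball_pos _ _ one_pos).ne'

theorem volume_ball_ne_top {E : Type*} [NormedAddCommGroup E] [InnerProductSpace ℂ E]
    [MeasureSpace E] [FiniteDimensional ℂ E] [(volume : Measure E).IsAddHaarMeasure] :
    volume (Metric.ball (0 : E) 1) ≠ ∞ := by
  have := FiniteDimensional.proper ℂ E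
  exact measure_ball_lt_top.ne

section Ball

variable {E : Type*} [NormedAddCommGroup E] [InnerProductSpace ℂ E] [MeasureSpace E]

theorem weightedBallMeasure_absolutelyContinuous (α : ℝ) :
    weightedBallMeasure E α ≪ (volume : Measure E).restrict (Metric.ball 0 1) :=
  (withDensity_absolutelyContinuous _ _).trans (Measure.AbsolutelyContinuous.rfl.smul_left _)

variable [BorelSpace E]

theorem measurable_weight (α : ℝ) :
    Measurable fun z : E => ENNReal.ofReal (bergmanConst E α * (1 - ‖z‖ ^ 2) ^ α) := by
  fun_prop

theorem lintegral_weightedBallMeasure (α : ℝ) (F : E → ℝ≥0∞) :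
    ∫⁻ z, F z ∂weightedBallMeasure E α = (volume (Metric.ball (0 : E) 1))⁻¹ *
      ∫⁻ z in Metric.ball (0 : E) 1,
        ENNReal.ofReal (bergmanConst E α * (1 - ‖z‖ ^ 2) ^ α) * F z := by
  unfold weightedBallMeasure ballMeasure
  rw [lintegral_withDensity_eq_lintegral_mul_non_measurable _ (measurable_weight α)
    (ae_of_all _ fun _ => ENNReal.ofReal_lt_top), lintegral_smul_measure]
  rfl

theorem ae_weightedBallMeasure_mem_ball (α : ℝ) :
    ∀ᵐ z ∂weightedBallMeasure E α, z ∈ Metric.ball (0 : E) 1 :=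
  (weightedBallMeasure_absolutelyContinuous α).ae_le (ae_restrict_mem measurableSet_ball)

variable [FiniteDimensional ℂ E]

theorem ContinuousOn.aestronglyMeasurable_weightedBallMeasure {f : E → ℂ}
    (hf : ContinuousOn f (Metric.ball 0 1)) (α : ℝ) :
    AEStronglyMeasurable f (weightedBallMeasure E α) := by
  have := FiniteDimensional.proper ℂ E
  exact (hf.aestronglyMeasurable measurableSet_ball).mono_ac
    (weightedBallMeasure_absolutelyContinuous α)

variable [(volume : Measure E).IsAddHaarMeasure]

theorem lintegral_one_sub_norm_rpow_lt_top [Nontrivial E] {β : ℝ} (hβ : -1 < β) :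
    ∫⁻ z in Metric.ball (0 : E) 1, ENNReal.ofReal ((1 - ‖z‖) ^ β) < ∞ := by
  have h1 : IntegrableOn (fun y : ℝ => (1 - y) ^ β) (Set.Ioo 0 1) := by
    have h := (intervalIntegral.intervalIntegrable_rpow' (a := 0) (b := 1) hβ).comp_sub_left 1
    rw [sub_zero, sub_self] at h
    exact ((intervalIntegrable_iff_integrableOn_Ioo_of_le zero_le_one).1 h.symm)
  have h2 : IntegrableOn (fun y : ℝ => y ^ (Module.finrank ℝ E - 1) • (1 - y) ^ β)
      (Set.Ioo 0 1) := by
    refine Integrable.bdd_mul (c := 1) h1 (by fun_prop) ?_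
    filter_upwards [ae_restrict_mem measurableSet_Ioo] with y hy
    rw [Real.norm_of_nonneg (by have := hy.1.le; positivity)]
    exact pow_le_one₀ hy.1.le hy.2.le
  exact ((integrableOn_fun_norm_addHaar (volume : Measure E)).2 h2).lintegral_lt_top

/-- `1 - |z|²` is comparable to `1 - |z|`. -/
theorem one_sub_sq_rpow_le {α t : ℝ} (h0 : 0 ≤ t) (h1 : t < 1) :
    (1 - t ^ 2) ^ α ≤ 2 ^ |α| * (1 - t) ^ α := by
  have e : 1 - t ^ 2 = (1 + t) * (1 - t) := by ring
  rw [e, Real.mul_rpow (by linarith) (by linarith)]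
  have h2 : 0 ≤ (1 - t) ^ α := Real.rpow_nonneg (by linarith) _
  gcongr
  calc (1 + t) ^ α ≤ (1 + t) ^ |α| :=
        Real.rpow_le_rpow_of_exponent_le (by linarith) (le_abs_self α)
    _ ≤ 2 ^ |α| := Real.rpow_le_rpow (by linarith) (by linarith) (abs_nonneg α)

theorem lintegral_rpow_weightedBallMeasure_lt_top [Nontrivial E] {α γ : ℝ} (hα : -1 < α)
    (hγ : γ < α + 1) :
    ∫⁻ z, ENNReal.ofReal ((1 - ‖z‖) ^ (-γ)) ∂weightedBallMeasure E α < ∞ := by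
  rw [lintegral_weightedBallMeasure]
  refine ENNReal.mul_lt_top (ENNReal.inv_lt_top.2 volume_ball_ne_zero.bot_lt) ?_
  have hb := bergmanConst_pos (E := E) hα
  calc ∫⁻ z in Metric.ball (0 : E) 1, ENNReal.ofReal (bergmanConst E α * (1 - ‖z‖ ^ 2) ^ α) *
        ENNReal.ofReal ((1 - ‖z‖) ^ (-γ))
      ≤ ∫⁻ z in Metric.ball (0 : E) 1, ENNReal.ofReal (bergmanConst E α * 2 ^ |α|) *
        ENNReal.ofReal ((1 - ‖z‖) ^ (α - γ)) := by
        refine setLIntegral_mono' measurableSet_ball fun z hz => ?_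
        rw [mem_ball_zero_iff] at hz
        have hz' : 0 < 1 - ‖z‖ := by linarith
        have h1 : 0 ≤ (1 - ‖z‖) ^ (-γ) := Real.rpow_nonneg hz'.le _
        rw [← ENNReal.ofReal_mul' h1, ← ENNReal.ofReal_mul (by positivity)]
        apply ENNReal.ofReal_le_ofReal
        rw [sub_eq_add_neg α γ, Real.rpow_add hz', ← mul_assoc,
          mul_assoc (bergmanConst E α) (2 ^ |α|)]
        exact mul_le_mul_of_nonneg_right (mul_le_mul_of_nonneg_left
          (one_sub_sq_rpow_le (norm_nonneg z) hz) hb.le) h1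
    _ < ∞ := by
        rw [lintegral_const_mul' _ _ ENNReal.ofReal_ne_top]
        exact ENNReal.mul_lt_top ENNReal.ofReal_lt_top
          (lintegral_one_sub_norm_rpow_lt_top (by linarith))

/-! ### Point evaluations -/

/-- Multiplication by a unimodular scalar preserves volume. -/
theorem measurePreserving_smul_of_norm_eq_one {c : ℂ} (hc : ‖c‖ = 1) :
    MeasurePreserving (fun z : E => c • z) volume volume := by
  have := FiniteDimensional.proper ℂ E
  have hm : Measurable fun z : E => c • z := by fun_prop
  have hc0 : c ≠ 0 := norm_ne_zero_iff.1 (by simp [hc])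
  set L : E ≃L[ℂ] E := ContinuousLinearEquiv.smulLeft (Units.mk0 c hc0)
  have hL : (fun z : E => c • z) = L := rfl
  have : (Measure.map (fun z : E => c • z) volume).IsAddHaarMeasure := by
    rw [hL]
    exact L.isAddHaarMeasure_map volume
  have h1 := Measure.isAddLeftInvariant_eq_smul (Measure.map (fun z : E => c • z) volume) volume
  -- The scaling factor is found by evaluating both measures on the unit ball.
  have h2 := congrArg (fun μ : Measure E => μ (Metric.ball 0 1)) h1
  have h3 : (fun z : E => c • z) ⁻¹' Metric.ball 0 1 = Metric.ball 0 1 := by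
    ext z
    simp [norm_smul, hc]
  simp only [Measure.smul_apply, Measure.map_apply hm measurableSet_ball, h3] at h2
  have h4 : Measure.addHaarScalarFactor (Measure.map (fun z : E => c • z) volume)
      (volume : Measure E) = 1 := by
    have h5 := (ENNReal.mul_eq_right volume_ball_ne_zero (volume_ball_ne_top (E := E))).1
      (show ((Measure.addHaarScalarFactor (Measure.map (fun z : E => c • z) volume)
        (volume : Measure E) : NNReal) : ℝ≥0∞) * volume (Metric.ball (0 : E) 1) = _ from h2.symm)
    exact_mod_cast h5
  refine ⟨hm, ?_⟩
  rw [h1, h4, one_smul]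

/-- The sub-mean value property of `ψ(|f|)` on balls: it is the one on the circles of the complex
lines through the centre, averaged over the ball. -/
theorem IsOrliczFunction.map_norm_mul_volume_le {ψ : ℝ → ℝ} (hψ : IsOrliczFunction ψ)
    {f : E → ℂ} {w : E} {R : ℝ} (hf : DifferentiableOn ℂ f (Metric.ball w R)) :
    ENNReal.ofReal (ψ ‖f w‖) * volume (Metric.ball (0 : E) R) ≤
      ∫⁻ z in Metric.ball w R, ENNReal.ofReal (ψ ‖f z‖) := by
  have := FiniteDimensional.proper ℂ E
  set g : E → ℝ := (Metric.ball w R).indicator fun z => ψ ‖f z‖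
  have hg : Measurable g := by
    classical
    rw [show g = (Metric.ball w R).piecewise (fun z => ψ ‖f z‖) 0 from
      Set.piecewise_eq_indicator.symm]
    exact (hψ.continuousOn.comp hf.continuousOn.norm fun z _ => norm_nonneg _).measurable_piecewise
      continuousOn_const measurableSet_ball
  set G : ℝ → E → ℝ≥0∞ := fun θ u => ENNReal.ofReal (g (w + circleMap 0 1 θ • u))
  have hG : Measurable (Function.uncurry G) := by
    have : Measurable fun p : ℝ × E => w + circleMap 0 1 p.1 • p.2 := by
      unfold circleMap
      fun_prop
    exact (hg.comp this).ennreal_ofReal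
  have hrot : ∀ θ : ℝ, ∫⁻ u, G θ u = ∫⁻ z in Metric.ball w R, ENNReal.ofReal (ψ ‖f z‖) := by
    intro θ
    have hm1 : Measurable fun z => ENNReal.ofReal (g (w + z)) := by fun_prop
    have h1 : ‖circleMap 0 1 θ‖ = 1 := by simp
    rw [(measurePreserving_smul_of_norm_eq_one h1).lintegral_comp hm1,
      lintegral_add_left_eq_self (fun z => ENNReal.ofReal (g z)) w,
      ← lintegral_indicator measurableSet_ball]
    refine lintegral_congr fun z => ?_
    by_cases hz : z ∈ Metric.ball w R
    · simp only [g, Set.indicator_of_mem hz]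
    · simp only [g, Set.indicator_of_notMem hz, ENNReal.ofReal_zero]
  have hcirc : ∀ u ∈ Metric.ball (0 : E) R, ENNReal.ofReal (2 * Real.pi) *
      ENNReal.ofReal (ψ ‖f w‖) ≤ ∫⁻ θ in Set.Ioo (-Real.pi) Real.pi, G θ u := by
    intro u hu
    rw [mem_ball_zero_iff] at hu
    have hmaps : Set.MapsTo (fun t : ℂ => w + t • u) (Metric.closedBall 0 1) (Metric.ball w R) := by
      intro t ht
      rw [mem_closedBall_zero_iff] at ht
      rw [mem_ball_iff_norm, add_sub_cancel_left, norm_smul]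
      exact (mul_le_of_le_one_left (norm_nonneg u) ht).trans_lt hu
    have hd : DifferentiableOn ℂ (fun t : ℂ => f (w + t • u)) (Metric.closedBall 0 1) :=
      hf.comp (by fun_prop) hmaps
    have hsub := hψ.map_norm_le_circleAverage hd (Metric.mem_ball_self one_pos)
    have hP : Real.circleAverage (fun z => poissonKernel 0 0 z * ψ ‖f (w + z • u)‖) 0 1 =
        Real.circleAverage (fun z => ψ ‖f (w + z • u)‖) 0 1 := by
      refine Real.circleAverage_congr_sphere fun z hz => ?_
      have hz1 : ‖z‖ = 1 := by simpa using hz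
      simp [poissonKernel_def, hz1]
    have hc : ContinuousOn (fun z : ℂ => ψ ‖f (w + z • u)‖) (Metric.closedBall 0 1) :=
      hψ.continuousOn.comp hd.continuousOn.norm fun z _ => norm_nonneg _
    calc ENNReal.ofReal (2 * Real.pi) * ENNReal.ofReal (ψ ‖f w‖)
        ≤ ENNReal.ofReal
          (2 * Real.pi * Real.circleAverage (fun z : ℂ => ψ ‖f (w + z • u)‖) 0 1) := by
          rw [← ENNReal.ofReal_mul Real.two_pi_pos.le]
          refine ENNReal.ofReal_le_ofReal (mul_le_mul_of_nonneg_left ?_ Real.two_pi_pos.le)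
          rw [← hP]
          simpa using hsub
      _ = ∫⁻ θ in Set.Ioo (-Real.pi) Real.pi, G θ u := by
          rw [← lintegral_circleMap_eq zero_le_one (hc.mono Metric.sphere_subset_closedBall)
            fun z _ => hψ.nonneg _ (norm_nonneg _)]
          refine lintegral_congr fun θ => ?_
          simp only [G, g]
          rw [Set.indicator_of_mem (hmaps (circleMap_mem_closedBall _ zero_le_one θ))]
  have hvol : volume (Set.Ioo (-Real.pi) Real.pi) = ENNReal.ofReal (2 * Real.pi) := by
    rw [Real.volume_Ioo]
    congr 1
    ring
  have hpi0 : ENNReal.ofReal (2 * Real.pi) ≠ 0 := by simpa using Real.pi_pos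
  refine (ENNReal.mul_le_mul_iff_right hpi0 ENNReal.ofReal_ne_top).1 ?_
  calc ENNReal.ofReal (2 * Real.pi) *
        (ENNReal.ofReal (ψ ‖f w‖) * volume (Metric.ball (0 : E) R))
      = ∫⁻ _ in Metric.ball (0 : E) R, ENNReal.ofReal (2 * Real.pi) *
          ENNReal.ofReal (ψ ‖f w‖) := by rw [setLIntegral_const, mul_assoc]
    _ ≤ ∫⁻ u in Metric.ball (0 : E) R, ∫⁻ θ in Set.Ioo (-Real.pi) Real.pi, G θ u :=
        setLIntegral_mono' measurableSet_ball hcirc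
    _ ≤ ∫⁻ u, ∫⁻ θ in Set.Ioo (-Real.pi) Real.pi, G θ u := setLIntegral_le_lintegral _ _
    _ = ∫⁻ θ in Set.Ioo (-Real.pi) Real.pi, ∫⁻ u, G θ u :=
        (lintegral_lintegral_swap hG.aemeasurable).symm
    _ = ENNReal.ofReal (2 * Real.pi) * ∫⁻ z in Metric.ball w R, ENNReal.ofReal (ψ ‖f z‖) := by
        simp only [hrot]
        rw [setLIntegral_const, hvol, mul_comm]

/-- The growth of the functions of the unit ball of the weighted Bergman–Orlicz space: `ψ(|f|)` is
bounded by a negative power of the distance to the sphere, which depends on the space only. -/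
theorem IsOrliczFunction.map_norm_le_of_orliczModular_le_one {ψ : ℝ → ℝ} (hψ : IsOrliczFunction ψ)
    {α : ℝ} (hα : -1 < α) {f : E → ℂ} (hf : DifferentiableOn ℂ f (Metric.ball 0 1)) {C : ℝ}
    (hmod : orliczModular ψ (weightedBallMeasure E α) C f ≤ 1) (hC : 0 < C) {w : E}
    (hw : w ∈ Metric.ball (0 : E) 1) :
    ψ (‖f w‖ / C) ≤ (bergmanConst E α)⁻¹ *
      ((1 - ‖w‖) / 2) ^ (-(|α| + Module.finrank ℝ E)) := by
  have := FiniteDimensional.proper ℂ E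
  rw [mem_ball_zero_iff] at hw
  have hb := bergmanConst_pos (E := E) hα
  set b := bergmanConst E α
  set R := (1 - ‖w‖) / 2 with hR
  have hR0 : 0 < R := by linarith
  have hsub : Metric.ball w R ⊆ Metric.ball (0 : E) 1 := by
    intro z hz
    rw [mem_ball_iff_norm] at hz
    rw [mem_ball_zero_iff]
    have := norm_le_norm_add_norm_sub' z w
    linarith
  have hnorm : ∀ z, ‖f z / C‖ = ‖f z‖ / C := fun z => by
    rw [norm_div, Complex.norm_real, Real.norm_of_nonneg hC.le]
  have h1 := hψ.map_norm_mul_volume_le (f := fun z => f z / C) (w := w) (R := R)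
    (by simpa only [div_eq_mul_inv] using (hf.mono hsub).mul_const (C : ℂ)⁻¹)
  simp only [hnorm] at h1
  set V := volume (Metric.ball (0 : E) 1)
  have hV0 : V ≠ 0 := volume_ball_ne_zero
  have hVt : V ≠ ∞ := volume_ball_ne_top
  have hvolR : volume (Metric.ball (0 : E) R) = ENNReal.ofReal (R ^ Module.finrank ℝ E) * V :=
    Measure.addHaar_ball_of_pos volume 0 hR0
  -- On the ball of radius `R` around `w`, the weight is bounded below by `R ^ |α|`.
  have h2 : ∫⁻ z in Metric.ball w R, ENNReal.ofReal (ψ (‖f z‖ / C)) ≤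
      ENNReal.ofReal (b⁻¹ * R ^ (-|α|)) * V := by
    rw [orliczModular, lintegral_weightedBallMeasure, mul_comm, ← div_eq_mul_inv,
      ENNReal.div_le_iff hV0 hVt, one_mul] at hmod
    calc ∫⁻ z in Metric.ball w R, ENNReal.ofReal (ψ (‖f z‖ / C))
        ≤ ∫⁻ z in Metric.ball w R, ENNReal.ofReal (b⁻¹ * R ^ (-|α|)) *
            (ENNReal.ofReal (b * (1 - ‖z‖ ^ 2) ^ α) * ENNReal.ofReal (ψ (‖f z‖ / C))) := by
          refine setLIntegral_mono' measurableSet_ball fun z hz => ?_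
          have hz1 := hsub hz
          rw [mem_ball_zero_iff] at hz1
          rw [mem_ball_iff_norm] at hz
          have hz2 := norm_le_norm_add_norm_sub' z w
          have hz0 := norm_nonneg z
          rw [← mul_assoc, ← ENNReal.ofReal_mul (by positivity)]
          refine le_mul_of_one_le_left' (ENNReal.one_le_ofReal.2 ?_)
          have hx : R ≤ 1 - ‖z‖ ^ 2 := by nlinarith
          have hx1 : 1 - ‖z‖ ^ 2 ≤ 1 := by nlinarith
          have h3 : R ^ |α| ≤ (1 - ‖z‖ ^ 2) ^ α :=
            (Real.rpow_le_rpow hR0.le hx (abs_nonneg α)).trans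
              (Real.rpow_le_rpow_of_exponent_ge (hR0.trans_le hx) hx1 (le_abs_self α))
          calc (1 : ℝ) = b⁻¹ * R ^ (-|α|) * (b * R ^ |α|) := by
                rw [Real.rpow_neg hR0.le]
                have := (Real.rpow_pos_of_pos hR0 |α|).ne'
                field_simp
            _ ≤ _ := by gcongr
      _ = ENNReal.ofReal (b⁻¹ * R ^ (-|α|)) * ∫⁻ z in Metric.ball w R,
            ENNReal.ofReal (b * (1 - ‖z‖ ^ 2) ^ α) * ENNReal.ofReal (ψ (‖f z‖ / C)) :=
          lintegral_const_mul' _ _ ENNReal.ofReal_ne_top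
      _ ≤ ENNReal.ofReal (b⁻¹ * R ^ (-|α|)) * V := by
          gcongr
          exact (lintegral_mono_set hsub).trans hmod
  have h3 := h1.trans h2
  rw [hvolR, ← mul_assoc, ENNReal.mul_le_mul_iff_left hV0 hVt,
    ← ENNReal.ofReal_mul (hψ.nonneg _ (by positivity)),
    ENNReal.ofReal_le_ofReal_iff (by positivity)] at h3
  rw [neg_add, Real.rpow_add hR0, Real.rpow_neg hR0.le (Module.finrank ℝ E : ℝ),
    Real.rpow_natCast, ← mul_assoc, ← div_eq_mul_inv, le_div_iff₀ (by positivity)]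
  exact h3

end Ball

/-! ### The Luxemburg norm and the modular -/

theorem IsOrliczFunction.orliczModular_mul_le {Ω : Type*} [MeasurableSpace Ω] {ψ : ℝ → ℝ}
    (hψ : IsOrliczFunction ψ) (μ : Measure Ω) {K C : ℝ} (hK : 1 ≤ K) (hC : 0 < C) (f : Ω → ℂ) :
    orliczModular ψ μ (K * C) f ≤ (ENNReal.ofReal K)⁻¹ * orliczModular ψ μ C f := by
  have hK0 : 0 < K := zero_lt_one.trans_le hK
  unfold orliczModular
  rw [← ENNReal.ofReal_inv_of_pos hK0, ← lintegral_const_mul' _ _ ENNReal.ofReal_ne_top]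
  refine lintegral_mono fun z => ?_
  rw [← ENNReal.ofReal_mul (inv_nonneg.2 hK0.le), mul_comm K C, ← div_div, inv_mul_eq_div]
  exact ENNReal.ofReal_le_ofReal (hψ.map_div_le hK (by positivity))

theorem IsOrliczFunction.orliczModular_mul_le_one {Ω : Type*} [MeasurableSpace Ω] {ψ : ℝ → ℝ}
    (hψ : IsOrliczFunction ψ) {μ : Measure Ω} {K C : ℝ} (hK : 1 ≤ K) (hC : 0 < C) {f : Ω → ℂ}
    (h : orliczModular ψ μ C f ≤ ENNReal.ofReal K) : orliczModular ψ μ (K * C) f ≤ 1 := by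
  refine (hψ.orliczModular_mul_le μ hK hC f).trans ?_
  rw [mul_comm, ← div_eq_mul_inv]
  exact ENNReal.div_le_of_le_mul (by rwa [one_mul])

theorem IsOrliczFunction.exists_orliczModular_le_one {Ω : Type*} [MeasurableSpace Ω] {ψ : ℝ → ℝ}
    (hψ : IsOrliczFunction ψ) {μ : Measure Ω} {f : Ω → ℂ} (hf : MemOrlicz ψ μ f) :
    ∃ C, 0 < C ∧ orliczModular ψ μ C f ≤ 1 := by
  obtain ⟨-, C, hC, hfin⟩ := hf
  refine ⟨max 1 (orliczModular ψ μ C f).toReal * C, by positivity,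
    hψ.orliczModular_mul_le_one (le_max_left _ _) hC ?_⟩
  rw [← ENNReal.ofReal_toReal hfin.ne]
  exact ENNReal.ofReal_le_ofReal (by simp)

section Ball

variable {E : Type*} [NormedAddCommGroup E] [InnerProductSpace ℂ E] [MeasureSpace E]
  [BorelSpace E] [FiniteDimensional ℂ E]

/-- A composition operator is bounded as soon as it maps the unit ball for the modular into a fixed
multiple of that unit ball. -/
theorem IsOrliczFunction.isBoundedCompositionOperator {ψ : ℝ → ℝ} (hψ : IsOrliczFunction ψ)
    {α : ℝ} {φ : E → E} (hφ : IsHolomorphicSelfMap φ) {K : ℝ} (hK : 0 < K)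
    (h : ∀ f : E → ℂ, DifferentiableOn ℂ f (Metric.ball 0 1) → ∀ C, 0 < C →
      orliczModular ψ (weightedBallMeasure E α) C f ≤ 1 →
      orliczModular ψ (weightedBallMeasure E α) (K * C) (f ∘ φ) ≤ 1) :
    IsBoundedCompositionOperator α ψ φ := by
  refine ⟨fun f hf => ?_, K, fun f hf => ?_⟩
  · obtain ⟨C, hC, hmod⟩ := hψ.exists_orliczModular_le_one hf.2
    have hd : DifferentiableOn ℂ (f ∘ φ) (Metric.ball 0 1) := hf.1.comp hφ.1 hφ.2
    exact ⟨hd, hd.continuousOn.aestronglyMeasurable_weightedBallMeasure α, K * C, by positivity,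
      (h f hf.1 C hC hmod).trans_lt ENNReal.one_lt_top⟩
  · obtain ⟨C₀, hC₀, hmod₀⟩ := hψ.exists_orliczModular_le_one hf.2
    rw [← div_le_iff₀' hK]
    refine le_csInf ⟨C₀, hC₀, hmod₀⟩ fun C hC => ?_
    rw [div_le_iff₀' hK]
    exact csInf_le ⟨0, fun x hx => hx.1.le⟩ ⟨mul_pos hK hC.1, h f hf.1 C hC.1 hC.2⟩

variable [(volume : Measure E).IsAddHaarMeasure] [Nontrivial E]

/-! ### Orlicz functions of fast growth -/

/-- Under the `Δ²`-Condition, the pointwise growth of the functions of the space together with the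
Schwarz–Pick estimate suffices: `ψ(|f ∘ φ|)` is at most a power of `1 / (1 - |z|)`, and the
`Δ²`-Condition trades a dilation for an integrable power. -/
theorem IsOrliczFunction.everyCompositionOperatorBounded {ψ : ℝ → ℝ} (hψ : IsOrliczFunction ψ)
    (hΔ : DeltaSquareCondition ψ) {α : ℝ} (hα : -1 < α) :
    EveryCompositionOperatorBounded E α ψ := by
  intro φ hφ
  have hb := bergmanConst_pos (E := E) hα
  set b := bergmanConst E α
  set β : ℝ := |α| + Module.finrank ℝ E
  have hβ : 0 ≤ β := by positivity
  have hα' : 0 < α + 1 := by linarith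
  have ha : ‖φ 0‖ < 1 := by simpa using hφ.2 (Metric.mem_ball_self one_pos)
  set c := (1 - ‖φ 0‖) / 4 with hc
  have hc0 : 0 < c := by linarith
  obtain ⟨k, hk⟩ := exists_nat_gt (β / (α + 1))
  have hk2 : (k : ℝ) < 2 ^ k := by exact_mod_cast Nat.lt_two_pow_self
  obtain ⟨A, hA, B, hB, hAB⟩ := hψ.exists_pow_map_div_le hΔ k
  set n : ℕ := 2 ^ k
  have hn0 : n ≠ 0 := by positivity
  have hn : (0 : ℝ) < n := by positivity
  have hγ : β / n < α + 1 := by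
    rw [div_lt_iff₀ hα'] at hk
    rw [div_lt_iff₀ hn]
    have : (k : ℝ) < n := by simpa [n] using hk2
    nlinarith
  set I := ∫⁻ z, ENNReal.ofReal ((1 - ‖z‖) ^ (-(β / n))) ∂weightedBallMeasure E α
  have hI : I < ∞ := lintegral_rpow_weightedBallMeasure_lt_top hα hγ
  set K₁ := b⁻¹ * c ^ (-β)
  have hK₁ : 0 < K₁ := by positivity
  set K₂ := (B * (1 + K₁)) ^ (n : ℝ)⁻¹
  have hK₂ : 0 ≤ K₂ := by positivity
  have hA0 : 0 < A := zero_lt_one.trans_le hA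
  refine hψ.isBoundedCompositionOperator hφ (K := max 1 (K₂ * I.toReal) * A) (by positivity)
    fun f hf C hC hmod => ?_
  rw [mul_assoc]
  refine hψ.orliczModular_mul_le_one (le_max_left _ _) (by positivity) ?_
  have hpt : ∀ z ∈ Metric.ball (0 : E) 1,
      ψ (‖f (φ z)‖ / (A * C)) ≤ K₂ * (1 - ‖z‖) ^ (-(β / n)) := by
    intro z hz
    have hsp := hφ.le_one_sub_norm hz
    have h1 := hψ.map_norm_le_of_orliczModular_le_one hα hf hmod hC (hφ.2 hz)
    rw [mem_ball_zero_iff] at hz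
    have hδ : 0 < 1 - ‖z‖ := by linarith
    have hδ1 : 1 - ‖z‖ ≤ 1 := by linarith [norm_nonneg z]
    have h2 : ψ (‖f (φ z)‖ / C) ≤ K₁ * (1 - ‖z‖) ^ (-β) := by
      refine h1.trans ?_
      rw [mul_assoc, ← Real.mul_rpow hc0.le hδ.le]
      refine mul_le_mul_of_nonneg_left ?_ (by positivity)
      exact Real.rpow_le_rpow_of_nonpos (by positivity) (by rw [hc]; linarith) (by linarith)
    have h3 : 1 ≤ (1 - ‖z‖) ^ (-β) :=
      Real.one_le_rpow_of_pos_of_le_one_of_nonpos hδ hδ1 (by linarith)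
    have h4 : ψ (‖f (φ z)‖ / (A * C)) ^ n ≤ B * (1 + K₁) * (1 - ‖z‖) ^ (-β) := by
      rw [mul_comm A C, ← div_div]
      refine (hAB _ (by positivity)).trans ?_
      rw [mul_assoc]
      exact mul_le_mul_of_nonneg_left (by linarith) hB
    have h5 : 0 ≤ ψ (‖f (φ z)‖ / (A * C)) := hψ.nonneg _ (by positivity)
    calc ψ (‖f (φ z)‖ / (A * C)) = (ψ (‖f (φ z)‖ / (A * C)) ^ n) ^ (n : ℝ)⁻¹ :=
          (Real.pow_rpow_inv_natCast h5 hn0).symm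
      _ ≤ (B * (1 + K₁) * (1 - ‖z‖) ^ (-β)) ^ (n : ℝ)⁻¹ :=
          Real.rpow_le_rpow (by positivity) h4 (by positivity)
      _ = K₂ * (1 - ‖z‖) ^ (-(β / n)) := by
          rw [Real.mul_rpow (by positivity) (by positivity), ← Real.rpow_mul hδ.le, neg_mul,
            ← div_eq_mul_inv]
  calc orliczModular ψ (weightedBallMeasure E α) (A * C) (f ∘ φ)
      ≤ ∫⁻ z, ENNReal.ofReal K₂ * ENNReal.ofReal ((1 - ‖z‖) ^ (-(β / n)))
          ∂weightedBallMeasure E α := by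
        refine lintegral_mono_ae ?_
        filter_upwards [ae_weightedBallMeasure_mem_ball α] with z hz
        rw [← ENNReal.ofReal_mul hK₂]
        exact ENNReal.ofReal_le_ofReal (hpt z hz)
    _ = ENNReal.ofReal (K₂ * I.toReal) := by
        rw [lintegral_const_mul' _ _ ENNReal.ofReal_ne_top, ENNReal.ofReal_mul hK₂,
          ENNReal.ofReal_toReal hI.ne]
    _ ≤ _ := ENNReal.ofReal_le_ofReal (le_max_right _ _)

/-! ### An unbounded function in the space of the exponential -/

theorem norm_log_one_sub_le {w : ℂ} {t : ℝ} (hw : ‖w‖ ≤ t) (ht : t < 1) :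
    ‖Complex.log (1 - w)‖ ≤ 1 + Real.pi - Real.log (1 - t) := by
  have h1 : 1 - t ≤ ‖1 - w‖ := by
    have := norm_sub_norm_le (1 : ℂ) w
    rw [norm_one] at this
    linarith
  have h2 : ‖1 - w‖ ≤ 2 := by
    have := norm_sub_le (1 : ℂ) w
    rw [norm_one] at this
    linarith
  have h0 : 0 < 1 - t := by linarith
  have h3 : Real.log (1 - t) ≤ Real.log ‖1 - w‖ := Real.log_le_log h0 h1
  have h4 : Real.log ‖1 - w‖ ≤ 1 := by
    have := Real.log_le_sub_one_of_pos (h0.trans_le h1)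
    linarith
  have h5 : Real.log (1 - t) ≤ 0 :=
    Real.log_nonpos h0.le (by linarith [norm_nonneg w])
  have h6 := Complex.norm_le_abs_re_add_abs_im (Complex.log (1 - w))
  rw [Complex.log_re, Complex.log_im] at h6
  have h7 := Complex.abs_arg_le_pi (1 - w)
  have h8 : |Real.log ‖1 - w‖| ≤ 1 - Real.log (1 - t) := abs_le.2 ⟨by linarith, by linarith⟩
  linarith

/-- The function `log (1 - ⟨u, z⟩)`, for a unit vector `u`, is unbounded but belongs to the space
given by `exp x - 1`. -/
theorem bergmanOrlicz_exp_sub_one_ne_hardyInfty {α : ℝ} (hα : -1 < α) :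
    bergmanOrlicz E α (fun x => Real.exp x - 1) ≠ hardyInfty E := by
  obtain ⟨u, hu⟩ := exists_norm_eq E zero_le_one
  have hα' : 0 < α + 1 := by linarith
  set f : E → ℂ := fun z => Complex.log (1 - innerSL ℂ u z)
  have hle : ∀ z, ‖innerSL ℂ u z‖ ≤ ‖z‖ := fun z => by
    rw [innerSL_apply_apply]
    simpa [hu] using norm_inner_le_norm (𝕜 := ℂ) u z
  have hd : DifferentiableOn ℂ f (Metric.ball 0 1) := by
    intro z hz
    rw [mem_ball_zero_iff] at hz
    have hre : 0 < (1 - innerSL ℂ u z).re := by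
      have := (Complex.re_le_norm (innerSL ℂ u z)).trans (hle z)
      rw [Complex.sub_re, Complex.one_re]
      linarith
    exact (((innerSL ℂ u).differentiableAt.const_sub 1).clog (Or.inl hre)).differentiableWithinAt
  intro heq
  have hmem : f ∈ bergmanOrlicz E α (fun x => Real.exp x - 1) := by
    refine ⟨hd, hd.continuousOn.aestronglyMeasurable_weightedBallMeasure α, 2 / (α + 1),
      by positivity, ?_⟩
    -- With `C = 2 / (α + 1)` the modular is finite, since `(1 - |z|) ^ (-(α + 1) / 2)` is
    -- integrable.
    have hγ : (α + 1) / 2 < α + 1 := by linarith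
    have hI := lintegral_rpow_weightedBallMeasure_lt_top (E := E) hα hγ
    set K := Real.exp ((1 + Real.pi) * ((α + 1) / 2))
    calc orliczModular (fun x => Real.exp x - 1) (weightedBallMeasure E α) (2 / (α + 1)) f
        ≤ ∫⁻ z, ENNReal.ofReal K * ENNReal.ofReal ((1 - ‖z‖) ^ (-((α + 1) / 2)))
            ∂weightedBallMeasure E α := by
          refine lintegral_mono_ae ?_
          filter_upwards [ae_weightedBallMeasure_mem_ball α] with z hz
          rw [mem_ball_zero_iff] at hz
          rw [← ENNReal.ofReal_mul (Real.exp_pos _).le]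
          refine ENNReal.ofReal_le_ofReal ?_
          rw [Real.rpow_def_of_pos (by linarith), ← Real.exp_add]
          have h1 : ‖f z‖ / (2 / (α + 1)) ≤ (1 + Real.pi) * ((α + 1) / 2) +
              Real.log (1 - ‖z‖) * -((α + 1) / 2) := by
            rw [div_div_eq_mul_div, mul_div_assoc]
            nlinarith [norm_log_one_sub_le (hle z) hz]
          linarith [Real.exp_le_exp.2 h1]
      _ < ∞ := by
          rw [lintegral_const_mul' _ _ ENNReal.ofReal_ne_top]
          exact ENNReal.mul_lt_top ENNReal.ofReal_lt_top hI
  rw [heq] at hmem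
  obtain ⟨-, M, hM⟩ := hmem
  have huu : innerSL ℂ u u = 1 := by
    rw [innerSL_apply_apply, inner_self_eq_norm_sq_to_K, hu]
    simp
  -- At `(1 - s) u` with `s = exp (-(|M| + 1))` the function takes the value `-(|M| + 1)`.
  set s := Real.exp (-(|M| + 1))
  have hs0 : 0 < s := Real.exp_pos _
  have hs1 : s < 1 := by
    rw [← Real.exp_zero]
    exact Real.exp_lt_exp.2 (by linarith [abs_nonneg M])
  have h := hM (((1 - s : ℝ) : ℂ) • u) (by
    rw [mem_ball_zero_iff, norm_smul, hu, Complex.norm_real, Real.norm_of_nonneg (by linarith)]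
    linarith)
  have hval : f (((1 - s : ℝ) : ℂ) • u) = ((-(|M| + 1) : ℝ) : ℂ) := by
    have h1 : (1 : ℂ) - innerSL ℂ u (((1 - s : ℝ) : ℂ) • u) = ((s : ℝ) : ℂ) := by
      rw [map_smul, huu]
      push_cast
      simp
    simp only [f, h1]
    rw [← Complex.ofReal_log hs0.le, Real.log_exp]
  rw [hval, Complex.norm_real, Real.norm_eq_abs, abs_neg] at h
  linarith [le_abs_self (|M| + 1), le_abs_self M]

end Ball

/-! ### The unit disc -/

theorem weight_le {α c r : ℝ} (hc0 : 0 < c) (hc1 : c ≤ 1 / 4) (hr0 : 0 < r) (hr1 : r < 1) :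
    (1 - r ^ 2) ^ α ≤ c⁻¹ ^ |α| * (1 - (1 - c * (1 - r)) ^ 2) ^ α := by
  set ρ := 1 - c * (1 - r) with hρ
  have hρ1 : ρ < 1 := by nlinarith
  have hρr : r ≤ ρ := by nlinarith
  have hpos : 0 < 1 - ρ ^ 2 := by nlinarith
  have hr : 0 < 1 - r ^ 2 := by nlinarith
  have e : 1 - ρ ^ 2 = c * ((1 - r) * (1 + ρ)) := by rw [hρ]; ring
  have h1 : 1 ≤ (1 - r ^ 2) / (1 - ρ ^ 2) := by
    rw [one_le_div hpos]
    nlinarith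
  have h2 : (1 - r ^ 2) / (1 - ρ ^ 2) ≤ c⁻¹ := by
    rw [div_le_iff₀ hpos, e, inv_mul_cancel_left₀ hc0.ne']
    nlinarith
  calc (1 - r ^ 2) ^ α = ((1 - r ^ 2) / (1 - ρ ^ 2)) ^ α * (1 - ρ ^ 2) ^ α := by
        rw [← Real.mul_rpow (by positivity) hpos.le, div_mul_cancel₀ _ hpos.ne']
    _ ≤ c⁻¹ ^ |α| * (1 - ρ ^ 2) ^ α := by
        refine mul_le_mul_of_nonneg_right ?_ (by positivity)
        exact (Real.rpow_le_rpow_of_exponent_le h1 (le_abs_self α)).trans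
          (Real.rpow_le_rpow (by positivity) h2 (abs_nonneg α))

/-- Littlewood's subordination principle for the weighted area measure: the circle of radius `r` is
compared with the circle of radius `1 - c (1 - r)`, which contains its image by the Schwarz–Pick
estimate when `c = (1 - |φ(0)|) / 4`. -/
theorem IsOrliczFunction.orliczModular_comp_le {ψ : ℝ → ℝ} (hψ : IsOrliczFunction ψ) {α : ℝ}
    (hα : -1 < α) {φ : ℂ → ℂ} (hφ : IsHolomorphicSelfMap φ) {f : ℂ → ℂ}
    (hf : DifferentiableOn ℂ f (Metric.ball 0 1)) {C : ℝ} (hC : 0 < C) {c : ℝ}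
    (hc : c = (1 - ‖φ 0‖) / 4) :
    orliczModular ψ (weightedBallMeasure ℂ α) C (f ∘ φ) ≤
      ENNReal.ofReal (c⁻¹ * c⁻¹ ^ |α| * c⁻¹) *
        orliczModular ψ (weightedBallMeasure ℂ α) C f := by
  have ha : ‖φ 0‖ < 1 := by simpa using hφ.2 (Metric.mem_ball_self one_pos)
  have ha0 := norm_nonneg (φ 0)
  have hc0 : 0 < c := by linarith
  have hc1 : c ≤ 1 / 4 := by linarith
  have hb := bergmanConst_pos (E := ℂ) hα
  set b := bergmanConst ℂ α
  set ω : ℝ → ℝ≥0∞ := fun r => ENNReal.ofReal (b * (1 - r ^ 2) ^ α)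
  have hω : Measurable ω := by fun_prop
  have hnorm : ∀ z, ‖f z / C‖ = ‖f z‖ / C := fun z => by
    rw [norm_div, Complex.norm_real, Real.norm_of_nonneg hC.le]
  have hfC : DifferentiableOn ℂ (fun z => f z / C) (Metric.ball 0 1) := by
    simpa only [div_eq_mul_inv] using hf.mul_const (C : ℂ)⁻¹
  set g : ℂ → ℝ := fun z => ψ (‖f z‖ / C)
  have hg0 : ∀ z, 0 ≤ g z := fun z => hψ.nonneg _ (by positivity)
  have hgc : ContinuousOn g (Metric.ball 0 1) :=
    hψ.continuousOn.comp (hf.continuousOn.norm.div_const C) fun z _ => by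
      simp only [Set.mem_Ici]
      positivity
  set H : ℝ → ℝ≥0∞ := fun s => ENNReal.ofReal s * ω s *
    ENNReal.ofReal (2 * Real.pi * Real.circleAverage g 0 s)
  have hcirc : ∀ r ∈ Set.Ioo (0 : ℝ) 1, ENNReal.ofReal r * ω r *
      ENNReal.ofReal (2 * Real.pi * Real.circleAverage (g ∘ φ) 0 r) ≤
      ENNReal.ofReal (c⁻¹ * c⁻¹ ^ |α|) * H (1 - c * (1 - r)) := by
    intro r hr
    set ρ := 1 - c * (1 - r) with hρ
    have hρ1 : ρ < 1 := by nlinarith [hr.2]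
    have hρr : r ≤ ρ := by nlinarith [hr.2]
    have hρ0 : 0 < ρ := hr.1.trans_le hρr
    have hmaps : Set.MapsTo φ (Metric.closedBall 0 r) (Metric.ball 0 ρ) := by
      intro z hz
      rw [mem_closedBall_zero_iff] at hz
      have h1 := hφ.le_one_sub_norm (z := z) (by simpa using hz.trans_lt hr.2)
      rw [mem_ball_zero_iff]
      nlinarith [hr.2]
    have h1 := hψ.circleAverage_comp_le hr.1
      (hfC.mono (Metric.closedBall_subset_ball hρ1))
      (hφ.1.mono (Metric.closedBall_subset_ball hr.2)) hmaps
    simp only [hnorm] at h1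
    have havg : 0 ≤ Real.circleAverage g 0 ρ :=
      Real.circleAverage_nonneg_of_nonneg fun z _ => hg0 z
    have h2 : Real.circleAverage (g ∘ φ) 0 r ≤ c⁻¹ * Real.circleAverage g 0 ρ := by
      refine h1.trans (mul_le_mul_of_nonneg_right ?_ havg)
      have h3 : 3 * c ≤ ρ - ‖φ 0‖ := by nlinarith [hr.1]
      rw [div_le_iff₀ (by linarith), inv_mul_eq_div, le_div_iff₀ hc0]
      nlinarith
    have h4 := weight_le (α := α) hc0 hc1 hr.1 hr.2
    have hw0 : 0 ≤ (1 - ρ ^ 2) ^ α := Real.rpow_nonneg (by nlinarith) _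
    have hw1 : 0 ≤ (1 - r ^ 2) ^ α := Real.rpow_nonneg (by nlinarith [hr.1, hr.2]) _
    have havg' : 0 ≤ Real.circleAverage (g ∘ φ) 0 r :=
      Real.circleAverage_nonneg_of_nonneg fun z _ => hg0 (φ z)
    have hpi := Real.pi_pos
    simp only [H, ω]
    rw [← ENNReal.ofReal_mul hr.1.le, ← ENNReal.ofReal_mul (mul_nonneg hr.1.le (by positivity)),
      ← ENNReal.ofReal_mul hρ0.le, ← ENNReal.ofReal_mul (by positivity),
      ← ENNReal.ofReal_mul (by positivity)]
    refine ENNReal.ofReal_le_ofReal ?_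
    calc r * (b * (1 - r ^ 2) ^ α) * (2 * Real.pi * Real.circleAverage (g ∘ φ) 0 r)
        ≤ ρ * (b * (c⁻¹ ^ |α| * (1 - ρ ^ 2) ^ α)) *
          (2 * Real.pi * (c⁻¹ * Real.circleAverage g 0 ρ)) := by gcongr
      _ = _ := by ring
  have hderiv : ∀ r ∈ Set.Ioo (0 : ℝ) 1,
      HasDerivWithinAt (fun r : ℝ => 1 - c * (1 - r)) c (Set.Ioo 0 1) r := by
    intro r _
    have h := ((((hasDerivAt_id r).const_sub 1).const_mul c).const_sub 1).hasDerivWithinAt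
      (s := Set.Ioo (0 : ℝ) 1)
    simpa using h
  have hinj : Set.InjOn (fun r : ℝ => 1 - c * (1 - r)) (Set.Ioo 0 1) := by
    intro x _ y _ hxy
    have : c * (x - y) = 0 := by
      simp only at hxy
      linarith
    rcases mul_eq_zero.1 this with h | h
    · exact absurd h hc0.ne'
    · linarith
  have hchange : ENNReal.ofReal c * ∫⁻ r in Set.Ioo (0 : ℝ) 1, H (1 - c * (1 - r)) ≤
      ∫⁻ s in Set.Ioo (0 : ℝ) 1, H s := by
    rw [← lintegral_const_mul' _ _ ENNReal.ofReal_ne_top]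
    have h := lintegral_image_eq_lintegral_abs_deriv_mul measurableSet_Ioo hderiv hinj H
    rw [abs_of_pos hc0] at h
    rw [← h]
    refine lintegral_mono_set ?_
    rintro _ ⟨r, hr, rfl⟩
    constructor <;> nlinarith [hr.1, hr.2]
  have hchange' : ∫⁻ r in Set.Ioo (0 : ℝ) 1, H (1 - c * (1 - r)) ≤
      ENNReal.ofReal c⁻¹ * ∫⁻ s in Set.Ioo (0 : ℝ) 1, H s := by
    calc _ = ENNReal.ofReal c⁻¹ * (ENNReal.ofReal c *
          ∫⁻ r in Set.Ioo (0 : ℝ) 1, H (1 - c * (1 - r))) := by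
          rw [← mul_assoc, ← ENNReal.ofReal_mul (by positivity), inv_mul_cancel₀ hc0.ne',
            ENNReal.ofReal_one, one_mul]
      _ ≤ _ := by gcongr
  have hgφ : ContinuousOn (g ∘ φ) (Metric.ball 0 1) := hgc.comp hφ.1.continuousOn hφ.2
  rw [orliczModular, orliczModular, lintegral_weightedBallMeasure, lintegral_weightedBallMeasure,
    mul_left_comm]
  refine mul_le_mul_right ?_ _
  calc ∫⁻ z in Metric.ball (0 : ℂ) 1, ω ‖z‖ * ENNReal.ofReal ((g ∘ φ) z)
      = ∫⁻ r in Set.Ioo (0 : ℝ) 1, ENNReal.ofReal r * ω r *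
        ENNReal.ofReal (2 * Real.pi * Real.circleAverage (g ∘ φ) 0 r) :=
        lintegral_ball_eq_lintegral_circleAverage hgφ (fun z _ => hg0 _) hω
    _ ≤ ∫⁻ r in Set.Ioo (0 : ℝ) 1, ENNReal.ofReal (c⁻¹ * c⁻¹ ^ |α|) * H (1 - c * (1 - r)) :=
        setLIntegral_mono' measurableSet_Ioo hcirc
    _ = ENNReal.ofReal (c⁻¹ * c⁻¹ ^ |α|) *
        ∫⁻ r in Set.Ioo (0 : ℝ) 1, H (1 - c * (1 - r)) :=
        lintegral_const_mul' _ _ ENNReal.ofReal_ne_top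
    _ ≤ ENNReal.ofReal (c⁻¹ * c⁻¹ ^ |α|) *
        (ENNReal.ofReal c⁻¹ * ∫⁻ s in Set.Ioo (0 : ℝ) 1, H s) := by gcongr
    _ = _ := by
        rw [← mul_assoc, ← ENNReal.ofReal_mul (by positivity),
          ← lintegral_ball_eq_lintegral_circleAverage hgc (fun z _ => hg0 z) hω]

theorem IsOrliczFunction.everyCompositionOperatorBounded_disc {ψ : ℝ → ℝ}
    (hψ : IsOrliczFunction ψ) {α : ℝ} (hα : -1 < α) : EveryCompositionOperatorBounded ℂ α ψ := by
  intro φ hφ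
  have ha : ‖φ 0‖ < 1 := by simpa using hφ.2 (Metric.mem_ball_self one_pos)
  set c := (1 - ‖φ 0‖) / 4 with hc
  have hc0 : 0 < c := by linarith
  have hci : 1 ≤ c⁻¹ := (one_le_inv₀ hc0).2 (by linarith [norm_nonneg (φ 0)])
  set K := c⁻¹ * c⁻¹ ^ |α| * c⁻¹
  have hK : 1 ≤ K := one_le_mul_of_one_le_of_one_le (one_le_mul_of_one_le_of_one_le hci
    (Real.one_le_rpow hci (abs_nonneg α))) hci
  refine hψ.isBoundedCompositionOperator hφ (zero_lt_one.trans_le hK) fun f hf C hC hmod => ?_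
  exact hψ.orliczModular_mul_le_one hK hC
    ((hψ.orliczModular_comp_le hα hφ hf hC hc).trans (mul_le_of_le_one_right' hmod))

theorem theorem3p7 (α : ℝ) (hα : -1 < α) :
    (∀ ψ : ℝ → ℝ, IsOrliczFunction ψ →
      EveryCompositionOperatorBounded ℂ α ψ ∧
      ∀ N : ℕ, 1 < N → DeltaSquareCondition ψ →
        EveryCompositionOperatorBounded (EuclideanSpace ℂ (Fin N)) α ψ) ∧
    (∃ ψ : ℝ → ℝ, IsOrliczFunction ψ ∧ DeltaSquareCondition ψ ∧
      (bergmanOrlicz ℂ α ψ ≠ hardyInfty ℂ ∧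
        EveryCompositionOperatorBounded ℂ α ψ) ∧
      ∀ N : ℕ, 1 < N →
        bergmanOrlicz (EuclideanSpace ℂ (Fin N)) α ψ ≠ hardyInfty (EuclideanSpace ℂ (Fin N)) ∧
        EveryCompositionOperatorBounded (EuclideanSpace ℂ (Fin N)) α ψ) := by
  have hnt : ∀ N : ℕ, 1 < N → Nontrivial (EuclideanSpace ℂ (Fin N)) := fun N hN => by
    have : NeZero N := ⟨by omega⟩
    infer_instance
  refine ⟨fun ψ hψ => ⟨hψ.everyCompositionOperatorBounded_disc hα, fun N hN hΔ => ?_⟩,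
    fun x => Real.exp x - 1, isOrliczFunction_exp_sub_one, deltaSquareCondition_exp_sub_one,
    ⟨bergmanOrlicz_exp_sub_one_ne_hardyInfty hα,
      isOrliczFunction_exp_sub_one.everyCompositionOperatorBounded_disc hα⟩, fun N hN => ?_⟩
  · have := hnt N hN
    exact hψ.everyCompositionOperatorBounded hΔ hα
  · have := hnt N hN
    exact ⟨bergmanOrlicz_exp_sub_one_ne_hardyInfty hα,
      isOrliczFunction_exp_sub_one.everyCompositionOperatorBounded
        deltaSquareCondition_exp_sub_one hα⟩
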